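/- Let $X$ be a complex Hilbert space with inner product linear in the first argument. Let $A:D(A)\subset X\to X$ be a closed linear operator that generates a strongly continuous semigroup $(T(t))_{t\ge0}$ on $X$, and assume that $A$ is a Riesz-spectral operator: its eigenvalues are simple and form a sequence $(\lambda_n)_{n\in\mathbb N}$ of distinct numbers, the set $\overline{\{\lambda_n:n\in\mathbb N\}}$ is totally disconnected, and the corresponding eigenvectors $(\phi_n)_{n\in\mathbb N}$ form a Riesz basis of $X$, i.e. their closed linear span is $X$ and there are $M_{\rm a},M_{\rm b}>0$ with $$M_{\rm a}\sum_{n=1}^N|a_n|^2\le\Big\|\sum_{n=1}^N a_n\phi_n\Big\|^2\le M_{\rm b}\sum_{n=1}^N|a_n|^2$$ for all $N\in\mathbb N$ and $a_1,\dots,a_N\in\mathbb C$. Let $(\psi_n)_{n\in\mathbb N}$ be eigenvectors of $A^*$, $A^*\psi_n=\overline{\lambda_n}\psi_n$, with $\langle\phi_n,\psi_m\rangle=1$ if $n=m$ and $0$ otherwise. Let $b,f\in X$, and define $B\in\mathcal L(\mathbb C,X)$ and $F\in\mathcal L(X,\mathbb C)$ by $Bu=bu$ and $Fx=\langle x,f\rangle$.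 Write $\sigma$, $\sigma_p$ and $R(\lambda,\cdot)=(\lambda I-\cdot)^{-1}$ for spectrum, point spectrum and resolvent. Assume: 1. there are $\alpha,\delta>0$ such that only finitely many $\lambda_n$ satisfy $\lambda_n\ne0$, $\operatorname{Re}\lambda_n>-\alpha$ and $|\arg\lambda_n|<\pi/2+\delta$; 2. $\{\lambda_n:n\in\mathbb N\}\cap i\mathbb R=\emptyset$; 3. $0\in\overline{\{\lambda_n:n\in\mathbb N\}}$; 4. $A+BF$ (with domain $D(A)$) generates a uniformly bounded strongly continuous semigroup on $X$, $\sigma_p(A+BF)\cap i\mathbb R=\emptyset$, $\sigma(A+BF)\cap i\mathbb R=\{0\}$, and $\sup_{\omega\in\mathbb R,\,|\omega|>1}\|R(i\omega,A+BF)\|<\infty$; 5. $\displaystyle\sum_{n=1}^\infty\left|\frac{\langle b,\psi_n\rangle}{\lambda_n}\right|^2<\infty$; 6. $\displaystyle\sum_{n=1}^\infty\frac{\langle b,\psi_n\rangle\langle\phi_n,f\rangle}{\lambda_n}\ne-1$. For $t\ge0$ put $S(t)=\int_0^tT(s)B\,ds\in\mathcal L(\mathbb C,X)$ and $\Delta(t)=T(t)+S(t)F\in\mathcal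 L(X)$, and let $\mathbb T=\{z\in\mathbb C:|z|=1\}$. Then there exists $\tau^*>0$ such that for every $\tau\in(0,\tau^*)$, $$\sigma_p(\Delta(\tau))\cap\mathbb T=\emptyset\qquad\text{and}\qquad\sigma(\Delta(\tau))\cap\mathbb T=\{1\}.$$ -/

import Mathlib

open Filter Topology

noncomputable section

namespace SampledData

variable {X : Type*} [NormedAddCommGroup X] [InnerProductSpace ℂ X]

/-! ### Unbounded operators: eigenvalues, spectrum, resolvent -/

/-- `v` is an eigenvector of the (possibly unbounded) operator `A` for the eigenvalue `μ`. -/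
def IsEigenvector (A : X →ₗ.[ℂ] X) (μ : ℂ) (v : X) : Prop :=
  v ≠ 0 ∧ ∃ hv : v ∈ A.domain, A ⟨v, hv⟩ = μ • v

/-- The point spectrum `σ_p(A)`, the set of eigenvalues. -/
def pointSpectrum (A : X →ₗ.[ℂ] X) : Set ℂ :=
  {μ | ∃ v, IsEigenvector A μ v}

/-- `μ` is a simple eigenvalue of `A`: the eigenspace is one-dimensional and there are no
generalized eigenvectors of rank two (so the algebraic multiplicity is one). -/
def IsSimpleEigenvalue (A : X →ₗ.[ℂ] X) (μ : ℂ) : Prop :=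
  ∃ v, IsEigenvector A μ v ∧
    (∀ w, IsEigenvector A μ w → w ∈ Submodule.span ℂ {v}) ∧
    ∀ x : A.domain, ¬ IsEigenvector A μ (A x - μ • (x : X))

/-- The bounded operator `R` is the two-sided inverse of `μ I - A : D(A) → X`. -/
def IsResolventAt (A : X →ₗ.[ℂ] X) (μ : ℂ) (R : X →L[ℂ] X) : Prop :=
  (∀ y : X, ∃ h : R y ∈ A.domain, μ • R y - A ⟨R y, h⟩ = y) ∧
    ∀ x : A.domain, R (μ • (x : X) - A x) = x

/-- The resolvent set `ρ(A)`. -/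
def resolventSet (A : X →ₗ.[ℂ] X) : Set ℂ :=
  {μ | ∃ R : X →L[ℂ] X, IsResolventAt A μ R}

/-- The spectrum `σ(A)`, the complement of the resolvent set. -/
def unboundedSpectrum (A : X →ₗ.[ℂ] X) : Set ℂ :=
  (resolventSet A)ᶜ

open Classical in
/-- The resolvent operator `R(μ, A) = (μ I - A)⁻¹` for `μ ∈ ρ(A)` (and `0` otherwise). -/
def unboundedResolvent (A : X →ₗ.[ℂ] X) (μ : ℂ) : X →L[ℂ] X :=
  if h : μ ∈ resolventSet A then h.choose else 0

theorem isResolventAt_unboundedResolvent {A : X →ₗ.[ℂ] X} {μ : ℂ} (h : μ ∈ resolventSet A) :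
    IsResolventAt A μ (unboundedResolvent A μ) := by
  unfold unboundedResolvent
  rw [dif_pos h]
  exact h.choose_spec

/-! ### Strongly continuous semigroups -/

/-- `T` restricted to `[0, ∞)` is a strongly continuous semigroup of bounded operators
(values at negative times are irrelevant). -/
structure IsC0Semigroup (T : ℝ → X →L[ℂ] X) : Prop where
  map_zero : T 0 = ContinuousLinearMap.id ℂ X
  map_add : ∀ s t : ℝ, 0 ≤ s → 0 ≤ t → T (s + t) = (T s).comp (T t)
  continuousOn : ∀ x : X, ContinuousOn (fun t : ℝ => T t x) (Set.Ici 0)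

/-- `A` is the infinitesimal generator of the semigroup `T`: `x ∈ D(A)` and `A x = y` hold exactly
when `(T(t) x - x) / t → y` as `t ↓ 0`. -/
def IsGenerator (T : ℝ → X →L[ℂ] X) (A : X →ₗ.[ℂ] X) : Prop :=
  ∀ x y : X, (x, y) ∈ A.graph ↔
    Tendsto (fun t : ℝ => ((t : ℂ)⁻¹) • (T t x - x)) (𝓝[>] 0) (𝓝 y)

/-- The semigroup `T` is uniformly bounded on `[0, ∞)`. -/
def IsUniformlyBounded (T : ℝ → X →L[ℂ] X) : Prop :=
  ∃ M : ℝ, ∀ t : ℝ, 0 ≤ t → ‖T t‖ ≤ M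

/-! ### Riesz-spectral operators -/

/-- The sequence `φ` is a Riesz basis of `X`. -/
def IsRieszBasis (φ : ℕ → X) : Prop :=
  closure (Submodule.span ℂ (Set.range φ) : Set X) = Set.univ ∧
    ∃ Ma Mb : ℝ, 0 < Ma ∧ 0 < Mb ∧ ∀ (N : ℕ) (a : ℕ → ℂ),
      Ma * ∑ n ∈ Finset.range N, ‖a n‖ ^ 2 ≤ ‖∑ n ∈ Finset.range N, a n • φ n‖ ^ 2 ∧
      ‖∑ n ∈ Finset.range N, a n • φ n‖ ^ 2 ≤ Mb * ∑ n ∈ Finset.range N, ‖a n‖ ^ 2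

/-- `A` is a Riesz-spectral operator whose eigenvalues are `lam 0, lam 1, …` (pairwise distinct,
simple) with corresponding eigenvectors `φ 0, φ 1, …`. -/
structure IsRieszSpectral (A : X →ₗ.[ℂ] X) (lam : ℕ → ℂ) (φ : ℕ → X) : Prop where
  isClosed : A.IsClosed
  injective : Function.Injective lam
  pointSpectrum_eq : pointSpectrum A = Set.range lam
  simple : ∀ n, IsSimpleEigenvalue A (lam n)
  eigenvector : ∀ n, IsEigenvector A (lam n) (φ n)
  rieszBasis : IsRieszBasis φ
  totallyDisconnected : IsTotallyDisconnected (closure (Set.range lam))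

/-! ### The sampled-data system -/

/-- The open half-plane `{s : Re s > α}`. -/
def halfPlane (α : ℝ) : Set ℂ := {s | α < s.re}

/-- The open sector `{s ≠ 0 : |arg s| < θ}`. -/
def sector (θ : ℝ) : Set ℂ := {s | s ≠ 0 ∧ |Complex.arg s| < θ}

/-- The imaginary axis `iℝ`. -/
def imaginaryAxis : Set ℂ := {s | s.re = 0}

/-- The operator `A + BF` with domain `D(A)`. -/
def closedLoop (A : X →ₗ.[ℂ] X) (B : ℂ →L[ℂ] X) (F : X →L[ℂ] ℂ) : X →ₗ.[ℂ] X :=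
  ((B.comp F : X →L[ℂ] X) : X →ₗ[ℂ] X) +ᵥ A

/-- `S(t) = ∫₀ᵗ T(s) B ds`, an element of `L(ℂ, X)`. -/
def inputOperator (T : ℝ → X →L[ℂ] X) (B : ℂ →L[ℂ] X) (t : ℝ) : ℂ →L[ℂ] X :=
  ∫ s in (0 : ℝ)..t, (T s).comp B

/-- `Δ(t) = T(t) + S(t) F`. -/
def sampledOperator (T : ℝ → X →L[ℂ] X) (B : ℂ →L[ℂ] X) (F : X →L[ℂ] ℂ) (t : ℝ) : X →L[ℂ] X :=
  T t + (inputOperator T B t).comp F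

/-- The standing assumption on the data `A`, `B`, `F`, where `lam`, `φ` are the eigenvalues and
eigenvectors of `A`, `ψ` is the biorthogonal sequence of eigenvectors of `A*`, and `b`, `f`
represent `B` and `F`. (Mathlib's inner product is linear in the second argument.) -/
structure SamplingAssumption [CompleteSpace X] (A : X →ₗ.[ℂ] X) (B : ℂ →L[ℂ] X) (F : X →L[ℂ] ℂ)
    (lam : ℕ → ℂ) (φ ψ : ℕ → X) (b f : X) : Prop where
  rieszSpectral : IsRieszSpectral A lam φ
  adjoint_eigenvector : ∀ n, IsEigenvector A.adjoint (starRingEnd ℂ (lam n)) (ψ n)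
  biorthogonal : ∀ n m, inner ℂ (ψ m) (φ n) = if n = m then (1 : ℂ) else 0
  B_eq : ∀ u : ℂ, B u = u • b
  F_eq : ∀ x : X, F x = inner ℂ f x
  finite_unstable : ∃ α δ : ℝ, 0 < α ∧ 0 < δ ∧
    (halfPlane (-α) ∩ sector (Real.pi / 2 + δ) ∩ Set.range lam).Finite
  no_imaginary_eigenvalue : Set.range lam ∩ imaginaryAxis = ∅
  zero_mem_closure : (0 : ℂ) ∈ closure (Set.range lam)
  closedLoop_generates : ∃ TBF : ℝ → X →L[ℂ] X,
    IsC0Semigroup TBF ∧ IsGenerator TBF (closedLoop A B F) ∧ IsUniformlyBounded TBF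
  closedLoop_pointSpectrum : pointSpectrum (closedLoop A B F) ∩ imaginaryAxis = ∅
  closedLoop_spectrum : unboundedSpectrum (closedLoop A B F) ∩ imaginaryAxis = {0}
  closedLoop_resolvent : ∃ M : ℝ, ∀ ω : ℝ, 1 < |ω| →
    ‖unboundedResolvent (closedLoop A B F) (ω * Complex.I)‖ ≤ M
  b_summable : Summable fun n => ‖inner ℂ (ψ n) b / lam n‖ ^ 2
  series_ne : ∑' n, inner ℂ (ψ n) b * inner ℂ f (φ n) / lam n ≠ -1

end SampledData

end

/-! In the coordinates `inner ℂ (ψ n) x` the operator T(τ) is diagonal with entries exp(λ_n τ), so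
Δ(τ) = T(τ) + S(τ)F is a rank-one perturbation of a diagonal operator. On the unit circle, z - Δ(τ)
is therefore governed by the scalar G_τ(z) = F R(z, T(τ)) S(τ), read as a series: if G_τ(z) ≠ 1,
then z is not an eigenvalue, and for z ≠ 1 also not in the spectrum.

The task is to keep G_τ away from 1. With z = exp(iθ), G_τ(z) is close to G(θ/τ), where G(ω) = F
R(iω, A) B, uniformly in θ as τ → 0 (`eventually_norm_sampledTransfer_sub_lt`). The limit G is
continuous and vanishes at infinity. It avoids 1 at ω = 0 by the series condition, and elsewhere
because G(ω) = 1 would make R(iω, A)b an eigenvector of A + BF. Hence |1 - G| has a positive lower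
bound, which passes to G_τ for small τ. Both limits rest on the summability of |c_n| / |Re λ_n|,
with c_n the product of the coordinates of b and f; it follows from the sector condition and from
the summability of |⟨b, ψ_n⟩ / λ_n|².

Finally, 1 lies in the spectrum because the φ_n with λ_n near 0 are approximate eigenvectors. -/

noncomputable section

namespace SampledData

/-! ### Riesz bases and their biorthogonal coordinates -/

section RieszBasis

variable {X : Type*} [NormedAddCommGroup X] [InnerProductSpace ℂ X] {φ ψ : ℕ → X}

/-- The upper Riesz bound for sums over arbitrary finite sets. -/
theorem IsRieszBasis.exists_norm_sum_sq_le (hφ : IsRieszBasis φ) :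
    ∃ M : ℝ, 0 < M ∧ ∀ (s : Finset ℕ) (a : ℕ → ℂ),
      ‖∑ n ∈ s, a n • φ n‖ ^ 2 ≤ M * ∑ n ∈ s, ‖a n‖ ^ 2 := by
  obtain ⟨-, Ma, Mb, -, hMb, h⟩ := hφ
  refine ⟨Mb, hMb, fun s a => ?_⟩
  obtain ⟨N, hN⟩ := s.exists_nat_subset_range
  have := (h N (fun n => if n ∈ s then a n else 0)).2
  simpa [ite_smul, apply_ite, Finset.sum_ite_mem, Finset.inter_eq_right.2 hN] using this

/-- By duality: pairing f with the combination of the φ n whose coefficients are the conjugates of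
`inner ℂ f (φ n)` gives the partial sum S itself, so Cauchy–Schwarz and the upper Riesz bound yield
S² ≤ ‖f‖² M S. -/
theorem IsRieszBasis.summable_sq_inner (hφ : IsRieszBasis φ) (f : X) :
    Summable fun n => ‖inner ℂ f (φ n)‖ ^ 2 := by
  obtain ⟨M, hM, h⟩ := hφ.exists_norm_sum_sq_le
  refine summable_of_sum_le (c := M * ‖f‖ ^ 2) (fun _ => by positivity) fun s => ?_
  set S := ∑ n ∈ s, ‖inner ℂ f (φ n)‖ ^ 2 with hS
  have hS0 : 0 ≤ S := Finset.sum_nonneg fun _ _ => by positivity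
  have h1 := h s (fun n => (starRingEnd ℂ) (inner ℂ f (φ n)))
  simp only [RCLike.norm_conj] at h1
  rw [← hS] at h1
  have h2 : inner ℂ f (∑ n ∈ s, (starRingEnd ℂ) (inner ℂ f (φ n)) • φ n) = (S : ℂ) := by
    rw [inner_sum, hS]
    push_cast
    refine Finset.sum_congr rfl fun n _ => ?_
    rw [inner_smul_right, RCLike.conj_mul]
    rfl
  have h3 := norm_inner_le_norm (𝕜 := ℂ) f (∑ n ∈ s, (starRingEnd ℂ) (inner ℂ f (φ n)) • φ n)
  rw [h2, Complex.norm_real, Real.norm_of_nonneg hS0] at h3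
  have h4 : S ^ 2 ≤ ‖f‖ ^ 2 * (M * S) := by
    calc S ^ 2 ≤ (‖f‖ * ‖∑ n ∈ s, (starRingEnd ℂ) (inner ℂ f (φ n)) • φ n‖) ^ 2 := by gcongr
      _ = ‖f‖ ^ 2 * ‖∑ n ∈ s, (starRingEnd ℂ) (inner ℂ f (φ n)) • φ n‖ ^ 2 := by ring
      _ ≤ _ := by gcongr
  rcases hS0.eq_or_lt with h0 | h0
  · rw [← h0]; positivity
  · refine le_of_mul_le_mul_right ?_ h0
    linarith

theorem inner_sum_of_biorthogonal
    (hb : ∀ n m, inner ℂ (ψ m) (φ n) = if n = m then (1 : ℂ) else 0) (N : ℕ) (a : ℕ → ℂ) (m : ℕ) :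
    inner ℂ (ψ m) (∑ n ∈ Finset.range N, a n • φ n) = if m < N then a m else 0 := by
  simp [hb]

theorem exists_sum_range_of_mem_span {x : X} (hx : x ∈ Submodule.span ℂ (Set.range φ)) :
    ∃ (N : ℕ) (a : ℕ → ℂ), x = ∑ n ∈ Finset.range N, a n • φ n := by
  obtain ⟨c, rfl⟩ := Finsupp.mem_span_range_iff_exists_finsupp.1 hx
  obtain ⟨N, hN⟩ := c.support.exists_nat_subset_range
  exact ⟨N, c, Finsupp.sum_of_support_subset c hN _ (by simp)⟩

/-- On finite combinations this is the lower Riesz bound. For fixed finite `s` both sides are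
continuous in x, so density of the span finishes. -/
theorem IsRieszBasis.exists_sum_sq_coord_le (hφ : IsRieszBasis φ)
    (hb : ∀ n m, inner ℂ (ψ m) (φ n) = if n = m then (1 : ℂ) else 0) :
    ∃ M : ℝ, 0 < M ∧ ∀ (s : Finset ℕ) (x : X), ∑ n ∈ s, ‖inner ℂ (ψ n) x‖ ^ 2 ≤ M * ‖x‖ ^ 2 := by
  obtain ⟨hd, Ma, Mb, hMa, -, h⟩ := hφ
  refine ⟨Ma⁻¹, by positivity, fun s x => ?_⟩
  have hcl : IsClosed {x : X | ∑ n ∈ s, ‖inner ℂ (ψ n) x‖ ^ 2 ≤ Ma⁻¹ * ‖x‖ ^ 2} :=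
    isClosed_le (by fun_prop) (by fun_prop)
  refine (hcl.closure_subset_iff.2 ?_) (hd ▸ Set.mem_univ x :
    x ∈ closure (Submodule.span ℂ (Set.range φ) : Set X))
  intro y hy
  obtain ⟨N, a, rfl⟩ := exists_sum_range_of_mem_span hy
  simp only [Set.mem_ofPred_eq, inner_sum_of_biorthogonal hb]
  have h1 := (h N a).1
  rw [inv_mul_eq_div, le_div_iff₀' hMa]
  refine le_trans ?_ h1
  gcongr
  calc ∑ n ∈ s, ‖if n < N then a n else 0‖ ^ 2
      = ∑ n ∈ s with n < N, ‖a n‖ ^ 2 := by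
        rw [Finset.sum_filter]
        exact Finset.sum_congr rfl fun n _ => by split_ifs <;> simp
    _ ≤ ∑ n ∈ Finset.range N, ‖a n‖ ^ 2 :=
        Finset.sum_le_sum_of_subset_of_nonneg (fun n hn => by simp_all) fun _ _ _ => by positivity

theorem IsRieszBasis.summable_sq_coord (hφ : IsRieszBasis φ)
    (hb : ∀ n m, inner ℂ (ψ m) (φ n) = if n = m then (1 : ℂ) else 0) (x : X) :
    Summable fun n => ‖inner ℂ (ψ n) x‖ ^ 2 := by
  obtain ⟨M, -, h⟩ := hφ.exists_sum_sq_coord_le hb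
  exact summable_of_sum_le (fun _ => by positivity) fun s => h s x

theorem IsRieszBasis.eq_zero_of_coord (hφ : IsRieszBasis φ)
    (hb : ∀ n m, inner ℂ (ψ m) (φ n) = if n = m then (1 : ℂ) else 0) {x : X}
    (hx : ∀ n, inner ℂ (ψ n) x = 0) : x = 0 := by
  obtain ⟨Ma, hMa, ha⟩ := hφ.exists_sum_sq_coord_le hb
  obtain ⟨Mb, hMb, hu⟩ := hφ.exists_norm_sum_sq_le
  -- Since x has zero coordinates, y and y - x have the same ones. The inequality is closed in y, so
  -- it may be evaluated at y = x, where the right side vanishes.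
  have key : ∀ y ∈ Submodule.span ℂ (Set.range φ), ‖y‖ ^ 2 ≤ Mb * (Ma * ‖y - x‖ ^ 2) := by
    intro y hy
    obtain ⟨N, a, rfl⟩ := exists_sum_range_of_mem_span hy
    refine (hu _ a).trans ?_
    gcongr
    refine le_trans (le_of_eq (Finset.sum_congr rfl fun n hn => ?_)) (ha (Finset.range N) _)
    rw [inner_sub_right, hx, inner_sum_of_biorthogonal hb, if_pos (Finset.mem_range.1 hn), sub_zero]
  have hcl : IsClosed {y : X | ‖y‖ ^ 2 ≤ Mb * (Ma * ‖y - x‖ ^ 2)} :=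
    isClosed_le (by fun_prop) (by fun_prop)
  have := (hcl.closure_subset_iff.2 key) (hφ.1 ▸ Set.mem_univ x :
    x ∈ closure (Submodule.span ℂ (Set.range φ) : Set X))
  simpa using this

theorem IsRieszBasis.ext_coord (hφ : IsRieszBasis φ)
    (hb : ∀ n m, inner ℂ (ψ m) (φ n) = if n = m then (1 : ℂ) else 0) {x y : X}
    (hxy : ∀ n, inner ℂ (ψ n) x = inner ℂ (ψ n) y) : x = y :=
  sub_eq_zero.1 (hφ.eq_zero_of_coord hb fun n => by rw [inner_sub_right, hxy, sub_self])

theorem IsRieszBasis.summable_smul [CompleteSpace X] (hφ : IsRieszBasis φ) {a : ℕ → ℂ}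
    (ha : Summable fun n => ‖a n‖ ^ 2) : Summable fun n => a n • φ n := by
  obtain ⟨M, hM, h⟩ := hφ.exists_norm_sum_sq_le
  rw [summable_iff_vanishing_norm]
  intro ε hε
  obtain ⟨s, hs⟩ := summable_iff_vanishing_norm.1 ha (ε ^ 2 / M) (by positivity)
  refine ⟨s, fun t ht => ?_⟩
  have h1 := hs t ht
  rw [Real.norm_of_nonneg (Finset.sum_nonneg fun _ _ => by positivity), lt_div_iff₀' hM] at h1
  exact lt_of_pow_lt_pow_left₀ 2 hε.le ((h t a).trans_lt h1)

theorem inner_of_hasSum_biorthogonal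
    (hb : ∀ n m, inner ℂ (ψ m) (φ n) = if n = m then (1 : ℂ) else 0) {a : ℕ → ℂ} {x : X}
    (hx : HasSum (fun n => a n • φ n) x) (m : ℕ) : inner ℂ (ψ m) x = a m := by
  have h1 := hx.mapL (innerSL ℂ (ψ m))
  have h2 : HasSum (fun n => innerSL ℂ (ψ m) (a n • φ n)) (a m) := by
    convert hasSum_ite_eq m (a m) using 2 with n
    by_cases h : n = m <;> simp [hb, h]
  exact h1.unique h2

theorem IsRieszBasis.hasSum_coord [CompleteSpace X] (hφ : IsRieszBasis φ)
    (hb : ∀ n m, inner ℂ (ψ m) (φ n) = if n = m then (1 : ℂ) else 0) (x : X) :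
    HasSum (fun n => (inner ℂ (ψ n) x : ℂ) • φ n) x := by
  obtain ⟨y, hy⟩ := hφ.summable_smul (hφ.summable_sq_coord hb x)
  have hxy : x = y := hφ.ext_coord hb fun n => (inner_of_hasSum_biorthogonal hb hy n).symm
  rwa [← hxy] at hy

theorem IsRieszBasis.hasSum_inner [CompleteSpace X] (hφ : IsRieszBasis φ)
    (hb : ∀ n m, inner ℂ (ψ m) (φ n) = if n = m then (1 : ℂ) else 0) (f x : X) :
    HasSum (fun n => (inner ℂ (ψ n) x * inner ℂ f (φ n) : ℂ)) (inner ℂ f x) := by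
  simpa [inner_smul_right] using (hφ.hasSum_coord hb x).mapL (innerSL ℂ f)

end RieszBasis

/-- A bounded multiplier preserves square summability. -/
theorem summable_sq_mul_of_bounded {a m : ℕ → ℂ} {C : ℝ} (hm : ∀ n, ‖m n‖ ≤ C)
    (ha : Summable fun n => ‖a n‖ ^ 2) : Summable fun n => ‖m n * a n‖ ^ 2 := by
  refine Summable.of_nonneg_of_le (fun _ => by positivity) (fun n => ?_) (ha.mul_left (C ^ 2))
  rw [norm_mul, mul_pow]
  gcongr
  exact hm n

theorem summable_norm_mul_of_sq {a b : ℕ → ℂ} (ha : Summable fun n => ‖a n‖ ^ 2)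
    (hb : Summable fun n => ‖b n‖ ^ 2) : Summable fun n => ‖a n * b n‖ := by
  refine Summable.of_nonneg_of_le (fun _ => by positivity) (fun n => ?_) (ha.add hb)
  rw [norm_mul]
  nlinarith [sq_nonneg (‖a n‖ - ‖b n‖), sq_nonneg ‖a n‖, sq_nonneg ‖b n‖]

/-! ### The semigroup and the sampled operator in coordinates -/

section Semigroup

variable {X : Type*} [NormedAddCommGroup X] [InnerProductSpace ℂ X] {T : ℝ → X →L[ℂ] X}
  {A : X →ₗ.[ℂ] X}

theorem IsEigenvector.mem_graph {μ : ℂ} {v : X} (h : IsEigenvector A μ v) :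
    (v, μ • v) ∈ A.graph := by
  obtain ⟨-, hv, h⟩ := h
  rw [← h]
  exact A.mem_graph ⟨v, hv⟩

/-- A semigroup acts on an eigenvector of its generator by the exponential of the eigenvalue. -/
theorem IsGenerator.apply_eigenvector (hA : IsGenerator T A) (hT : IsC0Semigroup T) {μ : ℂ} {v : X}
    (hv : IsEigenvector A μ v) {t : ℝ} (ht : 0 ≤ t) : T t v = Complex.exp (μ * t) • v := by
  have hlim := (hA v (μ • v)).1 hv.mem_graph
  have hderiv : ∀ s : ℝ, 0 ≤ s → HasDerivWithinAt (fun r => T r v) (μ • T s v) (Set.Ici s) s := by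
    intro s hs
    rw [← hasDerivWithinAt_Ioi_iff_Ici, hasDerivWithinAt_iff_tendsto_slope' Set.self_notMem_Ioi]
    have hshift : Tendsto (fun r : ℝ => r - s) (𝓝[>] s) (𝓝[>] 0) := by
      refine tendsto_nhdsWithin_iff.2 ⟨tendsto_nhdsWithin_of_tendsto_nhds ?_, ?_⟩
      · simpa using (continuous_sub_right s).tendsto s
      · filter_upwards [self_mem_nhdsWithin] with r hr
        exact sub_pos.2 (Set.mem_Ioi.1 hr)
    have h1 := ((T s).continuous.tendsto _).comp (hlim.comp hshift)
    rw [map_smul] at h1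
    refine h1.congr' ?_
    filter_upwards [self_mem_nhdsWithin] with r hr
    have h2 : T r v = T s (T (r - s) v) := by
      rw [← ContinuousLinearMap.comp_apply, ← hT.map_add s (r - s) hs (sub_pos.2 (Set.mem_Ioi.1 hr)).le,
        add_sub_cancel]
    rw [slope_def_module, h2, ← map_sub, ← Complex.coe_smul (r - s)⁻¹, ← map_smul]
    simp
  -- exp(-μr) T(r)v is constant. Only right derivatives enter, as the generator is a one-sided
  -- limit.
  have key := constant_of_has_deriv_right_zero (a := 0) (b := t)
    (f := fun r : ℝ => Complex.exp (-μ * r) • T r v) ?_ ?_ t ⟨ht, le_rfl⟩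
  · simp only [hT.map_zero, Complex.ofReal_zero, mul_zero, Complex.exp_zero, one_smul,
      ContinuousLinearMap.id_apply] at key
    conv_rhs => rw [← key, smul_smul, ← Complex.exp_add]
    simp
  · exact (by fun_prop : Continuous fun r : ℝ => Complex.exp (-μ * r)).continuousOn.smul
      ((hT.continuousOn v).mono Set.Icc_subset_Ici_self)
  · intro s hs
    have h1 : HasDerivAt (fun r : ℝ => Complex.exp (-μ * r)) (Complex.exp (-μ * s) * -μ) s := by
      have := ((hasDerivAt_id (s : ℂ)).const_mul (-μ)).cexp.comp_ofReal
      simpa using this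
    have := h1.hasDerivWithinAt.smul (hderiv s hs.1)
    have h0 : Complex.exp (-μ * s) • μ • T s v + (Complex.exp (-μ * s) * -μ) • T s v = 0 := by
      rw [smul_smul, ← add_smul, mul_neg, add_neg_cancel, zero_smul]
    rwa [h0] at this

variable {φ ψ : ℕ → X} {lam : ℕ → ℂ}

theorem IsGenerator.coord_apply [CompleteSpace X] (hA : IsGenerator T A) (hT : IsC0Semigroup T)
    (hφ : IsRieszBasis φ) (hb : ∀ n m, inner ℂ (ψ m) (φ n) = if n = m then (1 : ℂ) else 0)
    (hv : ∀ n, IsEigenvector A (lam n) (φ n)) {t : ℝ} (ht : 0 ≤ t) (x : X) (n : ℕ) :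
    inner ℂ (ψ n) (T t x) = Complex.exp (lam n * t) * inner ℂ (ψ n) x := by
  have h1 := (hφ.hasSum_coord hb x).mapL (T t)
  simp only [map_smul, hA.apply_eigenvector hT (hv _) ht, smul_smul] at h1
  rw [inner_of_hasSum_biorthogonal hb h1, mul_comm]

theorem inputOperator_coord [CompleteSpace X] (hA : IsGenerator T A) (hT : IsC0Semigroup T)
    (hφ : IsRieszBasis φ) (hb : ∀ n m, inner ℂ (ψ m) (φ n) = if n = m then (1 : ℂ) else 0)
    (hv : ∀ n, IsEigenvector A (lam n) (φ n)) (hlam : ∀ n, lam n ≠ 0) {B : ℂ →L[ℂ] X} {b : X}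
    (hB : ∀ u : ℂ, B u = u • b) {t : ℝ} (ht : 0 ≤ t) (u : ℂ) (n : ℕ) :
    inner ℂ (ψ n) (inputOperator T B t u) =
      u * inner ℂ (ψ n) b * ((Complex.exp (lam n * t) - 1) / lam n) := by
  let L : (ℂ →L[ℂ] X) →L[ℂ] ℂ := (innerSL ℂ (ψ n)).comp (ContinuousLinearMap.apply ℂ X u)
  have hL : ∀ S : ℂ →L[ℂ] X, L S = inner ℂ (ψ n) (S u) := fun S => rfl
  -- As B has rank one, strong continuity at b gives operator-norm continuity of s ↦ T(s)B, hence
  -- integrability.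
  have heq : ∀ s, (T s).comp B = ContinuousLinearMap.smulRightL ℂ ℂ X 1 (T s b) := by
    intro s
    ext
    simp [hB]
  have hint : IntervalIntegrable (fun s => (T s).comp B) MeasureTheory.volume 0 t := by
    apply ContinuousOn.intervalIntegrable
    simp only [heq]
    refine (ContinuousLinearMap.continuous _).comp_continuousOn ((hT.continuousOn b).mono ?_)
    rw [Set.uIcc_of_le ht]
    exact Set.Icc_subset_Ici_self
  rw [← hL, inputOperator, ← L.intervalIntegral_comp_comm hint]
  have : Set.EqOn (fun s => L ((T s).comp B))
      (fun s : ℝ => u * inner ℂ (ψ n) b * Complex.exp (lam n * s)) (Set.uIcc 0 t) := by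
    intro s hs
    rw [Set.uIcc_of_le ht] at hs
    simp only [hL, ContinuousLinearMap.comp_apply, hB, map_smul, inner_smul_right,
      hA.coord_apply hT hφ hb hv hs.1]
    ring
  rw [intervalIntegral.integral_congr this, intervalIntegral.integral_const_mul,
    integral_exp_mul_complex (hlam n)]
  simp

theorem sampledOperator_coord [CompleteSpace X] (hA : IsGenerator T A) (hT : IsC0Semigroup T)
    (hφ : IsRieszBasis φ) (hb : ∀ n m, inner ℂ (ψ m) (φ n) = if n = m then (1 : ℂ) else 0)
    (hv : ∀ n, IsEigenvector A (lam n) (φ n)) (hlam : ∀ n, lam n ≠ 0) {B : ℂ →L[ℂ] X} {b : X}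
    (hB : ∀ u : ℂ, B u = u • b) (F : X →L[ℂ] ℂ) {t : ℝ} (ht : 0 ≤ t) (x : X) (n : ℕ) :
    inner ℂ (ψ n) (sampledOperator T B F t x) =
      Complex.exp (lam n * t) * inner ℂ (ψ n) x +
        F x * inner ℂ (ψ n) b * ((Complex.exp (lam n * t) - 1) / lam n) := by
  rw [sampledOperator, add_apply, inner_add_right, hA.coord_apply hT hφ hb hv ht,
    ContinuousLinearMap.comp_apply, inputOperator_coord hA hT hφ hb hv hlam hB ht]

/-- A closed operator with a Riesz basis of eigenvectors acts coordinatewise whenever the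
resulting coordinates are square summable. -/
theorem IsRieszSpectral.mem_graph_of_coord [CompleteSpace X] (hR : IsRieszSpectral A lam φ)
    (hb : ∀ n m, inner ℂ (ψ m) (φ n) = if n = m then (1 : ℂ) else 0) {x y : X}
    (hxy : ∀ n, inner ℂ (ψ n) y = lam n * inner ℂ (ψ n) x) : (x, y) ∈ A.graph := by
  have hx := (hR.rieszBasis.hasSum_coord hb x)
  have hy := (hR.rieszBasis.hasSum_coord hb y)
  refine IsClosed.mem_of_tendsto hR.isClosed (hx.prodMk hy) (Eventually.of_forall fun s => ?_)
  refine A.graph.sum_mem fun n _ => ?_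
  have := A.graph.smul_mem (inner ℂ (ψ n) x) (hR.eigenvector n).mem_graph
  rwa [Prod.smul_mk, smul_smul, mul_comm, ← hxy] at this

end Semigroup

/-! ### Estimates for the scalar symbols -/

section Estimates

/-- Mean value inequality on the convex left half-plane, where the derivative of exp has modulus at
most 1. -/
theorem norm_exp_sub_one_le_of_re_nonpos {w : ℂ} (hw : w.re ≤ 0) :
    ‖Complex.exp w - 1‖ ≤ ‖w‖ := by
  have := (convex_halfSpace_re_le 0).norm_image_sub_le_of_norm_deriv_le (𝕜 := ℂ) (f := Complex.exp)
    (C := 1) (x := 0) (y := w) (fun _ _ => Complex.differentiableAt_exp)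
    (fun x hx => by
      rw [Complex.deriv_exp, Complex.norm_exp]
      exact Real.exp_le_one_iff.2 hx) (by simp) hw
  simpa using this

theorem abs_one_sub_exp_inv_le {x : ℝ} (hx : x ≠ 0) : |1 - Real.exp x|⁻¹ ≤ 1 + |x|⁻¹ := by
  have h1 : Real.exp x ≠ 1 := by simpa using hx
  have h2 : 0 < |1 - Real.exp x| := abs_pos.2 (sub_ne_zero.2 h1.symm)
  have h3 : 0 < |x| := abs_pos.2 hx
  rw [inv_le_comm₀ h2 (by positivity)]
  rcases lt_or_gt_of_ne hx with h | h
  · have he : Real.exp x ≤ (1 + |x|)⁻¹ := by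
      rw [le_inv_comm₀ (Real.exp_pos _) (by positivity), ← Real.exp_neg, abs_of_neg h]
      linarith [Real.add_one_le_exp (-x)]
    calc (1 + |x|⁻¹)⁻¹ = 1 - (1 + |x|)⁻¹ := by field_simp; ring
      _ ≤ 1 - Real.exp x := by linarith
      _ ≤ _ := le_abs_self _
  · calc (1 + |x|⁻¹)⁻¹ ≤ (|x|⁻¹)⁻¹ := by gcongr; linarith
      _ = x := by rw [inv_inv, abs_of_pos h]
      _ ≤ Real.exp x - 1 := by linarith [Real.add_one_le_exp x]
      _ ≤ _ := by rw [abs_sub_comm]; exact le_abs_self _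

theorem sub_exp_ne_zero {z w : ℂ} (hz : ‖z‖ = 1) (hw : w.re ≠ 0) : z - Complex.exp w ≠ 0 := by
  intro h
  rw [sub_eq_zero.1 h, Complex.norm_exp, Real.exp_eq_one_iff] at hz
  exact hw hz

theorem norm_sub_exp_inv_le {z w : ℂ} (hz : ‖z‖ = 1) (hw : w.re ≠ 0) :
    ‖(z - Complex.exp w)⁻¹‖ ≤ 1 + |w.re|⁻¹ := by
  refine le_trans ?_ (abs_one_sub_exp_inv_le hw)
  rw [norm_inv]
  have h1 : Real.exp w.re ≠ 1 := by simpa using hw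
  have h2 : 0 < |1 - Real.exp w.re| := abs_pos.2 (sub_ne_zero.2 h1.symm)
  gcongr
  simpa [hz, Complex.norm_exp] using abs_norm_sub_norm_le z (Complex.exp w)

theorem norm_I_mul_sub_inv_le (ω : ℝ) {μ : ℂ} (hμ : μ.re ≠ 0) :
    ‖(Complex.I * ω - μ)⁻¹‖ ≤ |μ.re|⁻¹ := by
  rw [norm_inv]
  have := abs_pos.2 hμ
  gcongr
  simpa using Complex.abs_re_le_norm (Complex.I * ω - μ)

theorem I_mul_sub_ne_zero (ω : ℝ) {μ : ℂ} (hμ : μ.re ≠ 0) : Complex.I * ω - μ ≠ 0 := by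
  intro h
  apply hμ
  simpa using congrArg Complex.re h

/-- The `n`-th diagonal entry of `R(z, T(τ)) S(τ)` divided by the `n`-th coordinate of `b`, when
`μ` is the `n`-th eigenvalue. -/
def sampledSymbol (τ : ℝ) (z μ : ℂ) : ℂ :=
  (Complex.exp (μ * τ) - 1) / (μ * (z - Complex.exp (μ * τ)))

/-- The bound |exp(μτ) - 1| ≤ |μ|τ cancels the factor 1/μ. The result does not depend on z, as
domination on the whole circle requires. -/
theorem norm_sampledSymbol_le_of_neg {τ : ℝ} (hτ : 0 < τ) {z μ : ℂ} (hz : ‖z‖ = 1)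
    (hμ : μ.re < 0) : ‖sampledSymbol τ z μ‖ ≤ τ + |μ.re|⁻¹ := by
  have hμ0 : μ ≠ 0 := by rintro rfl; simp at hμ
  have hre : (μ * τ).re = μ.re * τ := by simp
  have h1 : ‖Complex.exp (μ * τ) - 1‖ ≤ ‖μ‖ * τ := by
    have := norm_exp_sub_one_le_of_re_nonpos (w := μ * τ)
      (by rw [hre]; exact (mul_neg_of_neg_of_pos hμ hτ).le)
    simpa [abs_of_pos hτ] using this
  have h2 := norm_sub_exp_inv_le (w := μ * τ) hz (by rw [hre]; exact (mul_neg_of_neg_of_pos hμ hτ).ne)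
  have hpos : 0 < |μ.re| := abs_pos.2 hμ.ne
  calc ‖sampledSymbol τ z μ‖
      = ‖Complex.exp (μ * τ) - 1‖ * ‖μ‖⁻¹ * ‖(z - Complex.exp (μ * τ))⁻¹‖ := by
        rw [sampledSymbol, div_eq_mul_inv, mul_inv, norm_mul, norm_mul, norm_inv μ, mul_assoc]
    _ ≤ ‖μ‖ * τ * ‖μ‖⁻¹ * (1 + |(μ * τ).re|⁻¹) := by gcongr
    _ = τ + |μ.re|⁻¹ := by
        have : ‖μ‖ ≠ 0 := norm_ne_zero_iff.2 hμ0
        rw [hre, abs_mul, abs_of_pos hτ]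
        field_simp

/-- The reflection (z, μ) ↦ (z⁻¹, -μ) carries the left half-plane bound to the right half-plane. -/
theorem sampledSymbol_neg (τ : ℝ) {z μ : ℂ} (hz : z ≠ 0) :
    sampledSymbol τ z μ = -(z⁻¹ * sampledSymbol τ z⁻¹ (-μ)) := by
  unfold sampledSymbol
  have he := Complex.exp_ne_zero (μ * τ)
  rcases eq_or_ne μ 0 with rfl | hμ
  · simp
  rw [neg_mul, Complex.exp_neg]
  rcases eq_or_ne (z - Complex.exp (μ * τ)) 0 with h | h
  · rw [sub_eq_zero.1 h]; simp
  have h' : z⁻¹ - (Complex.exp (μ * τ))⁻¹ ≠ 0 := by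
    rw [sub_ne_zero] at h ⊢
    simpa using h
  have h'' : Complex.exp (μ * τ) - z ≠ 0 := by rwa [sub_ne_zero, ne_comm, ← sub_ne_zero]
  have e1 : z⁻¹ - (Complex.exp (μ * τ))⁻¹ = (Complex.exp (μ * τ) - z) / (z * Complex.exp (μ * τ)) := by
    field_simp
  rw [e1]
  field_simp
  ring

theorem norm_sampledSymbol_le {τ : ℝ} (hτ : 0 < τ) {z μ : ℂ} (hz : ‖z‖ = 1) (hμ : μ.re ≠ 0) :
    ‖sampledSymbol τ z μ‖ ≤ τ + |μ.re|⁻¹ := by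
  rcases lt_or_gt_of_ne hμ with h | h
  · exact norm_sampledSymbol_le_of_neg hτ hz h
  · have hz0 : z ≠ 0 := by rintro rfl; simp at hz
    have := norm_sampledSymbol_le_of_neg hτ (z := z⁻¹) (μ := -μ) (by simp [hz]) (by simpa using h)
    rw [sampledSymbol_neg τ hz0]
    simpa [hz] using this

/-- The divided difference of exp at 0 is continuous and has no zero of modulus below 2π, so it is
bounded below on the disc. The radius 5 is chosen between π + 1 and 2π, since it is applied to w =
iθ - μτ with |θ| ≤ π and |μ|τ < 1. -/
theorem exists_le_norm_exp_sub_one :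
    ∃ m : ℝ, 0 < m ∧ ∀ w : ℂ, ‖w‖ ≤ 5 → m * ‖w‖ ≤ ‖Complex.exp w - 1‖ := by
  have hc : Continuous (dslope Complex.exp 0) := by
    rw [continuous_iff_continuousAt]
    intro w
    rcases eq_or_ne w 0 with rfl | hw
    · exact continuousAt_dslope_same.2 Complex.differentiableAt_exp
    · exact (continuousAt_dslope_of_ne hw).2 Complex.continuous_exp.continuousAt
  obtain ⟨w₀, hw₀, hmin⟩ := (isCompact_closedBall (0 : ℂ) 5).exists_isMinOn ⟨0, by simp⟩
    hc.norm.continuousOn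
  refine ⟨‖dslope Complex.exp 0 w₀‖, ?_, fun w hw => ?_⟩
  · rw [norm_pos_iff]
    rcases eq_or_ne w₀ 0 with rfl | h0
    · simp
    · rw [dslope_of_ne _ h0, slope_def_field]
      refine div_ne_zero ?_ (by simpa using h0)
      rw [Complex.exp_zero, sub_ne_zero]
      intro h
      obtain ⟨n, hn⟩ := Complex.exp_eq_one_iff.1 h
      have hn0 : n ≠ 0 := by rintro rfl; simp at hn; exact h0 hn
      have : (1 : ℝ) ≤ |(n : ℝ)| := by exact_mod_cast Int.one_le_abs hn0
      have h5 : ‖w₀‖ ≤ 5 := by simpa using hw₀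
      rw [hn] at h5
      simp [abs_of_pos Real.pi_pos] at h5
      nlinarith [Real.pi_gt_three]
  · have h1 : ‖dslope Complex.exp 0 w₀‖ ≤ ‖dslope Complex.exp 0 w‖ := hmin (by simpa using hw)
    have h2 : Complex.exp w - 1 = w * dslope Complex.exp 0 w := by
      have := sub_smul_dslope Complex.exp 0 w
      simpa using this.symm
    rw [h2, norm_mul, mul_comm]
    gcongr

theorem norm_exp_sub_one_sub_le (w : ℂ) :
    ‖Complex.exp w - 1 - w‖ ≤ ‖w‖ ^ 2 * Real.exp ‖w‖ := by
  have := Complex.norm_exp_sub_sum_le_norm_mul_exp w 2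
  simpa [Finset.sum_range_succ, sub_sub] using this

/-- On the unit circle the sampled symbol is uniformly approximated by the continuous-time one. -/
theorem exists_norm_sampledSymbol_sub_le {μ : ℂ} (hμ : μ.re ≠ 0) :
    ∃ g : ℝ → ℝ, Tendsto g (𝓝[>] 0) (𝓝 0) ∧ ∀ᶠ τ in 𝓝[>] (0 : ℝ), ∀ θ : ℝ, |θ| ≤ Real.pi →
      ‖sampledSymbol τ (Complex.exp (θ * Complex.I)) μ -
        (Complex.I * ((θ / τ : ℝ) : ℂ) - μ)⁻¹‖ ≤ g τ := by
  obtain ⟨m, hm, hlow⟩ := exists_le_norm_exp_sub_one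
  have hμ0 : μ ≠ 0 := by rintro rfl; simp at hμ
  have hpos : 0 < |μ.re| := abs_pos.2 hμ
  -- Dividing through by exp(μτ), the sampled symbol is k(τ) / (exp w - 1) with w = iθ - μτ, while
  -- the continuous-time symbol is τ / w.
  let k : ℝ → ℂ := fun τ => (1 - Complex.exp (-(μ * τ))) / μ
  refine ⟨fun τ => ‖k τ‖ * (Real.exp 5 / m) + ‖μ‖ * τ * Real.exp (‖μ‖ * τ) / |μ.re|, ?_, ?_⟩
  · refine tendsto_nhdsWithin_of_tendsto_nhds ?_
    have : Continuous fun τ : ℝ =>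
        ‖k τ‖ * (Real.exp 5 / m) + ‖μ‖ * τ * Real.exp (‖μ‖ * τ) / |μ.re| := by
      simp only [k]
      fun_prop
    convert this.tendsto 0 using 2
    simp [k]
  · have hsmall : ∀ᶠ τ in 𝓝[>] (0 : ℝ), ‖μ‖ * τ < 1 := by
      refine (tendsto_nhdsWithin_of_tendsto_nhds ?_).eventually_lt_const (zero_lt_one)
      have : Continuous fun τ : ℝ => ‖μ‖ * τ := by fun_prop
      simpa using this.tendsto 0
    filter_upwards [hsmall, self_mem_nhdsWithin] with τ hτ1 hτ θ hθ
    have hτ0 : (0 : ℝ) < τ := hτ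
    have hτc : (τ : ℂ) ≠ 0 := by exact_mod_cast hτ0.ne'
    set w : ℂ := θ * Complex.I - μ * τ with hw
    have hwre : w.re = -(μ.re * τ) := by simp [hw]
    have hw_ge : τ * |μ.re| ≤ ‖w‖ := by
      have := Complex.abs_re_le_norm w
      rwa [hwre, abs_neg, abs_mul, abs_of_pos hτ0, mul_comm] at this
    have hwpos : 0 < ‖w‖ := lt_of_lt_of_le (by positivity) hw_ge
    have hw0 : w ≠ 0 := norm_pos_iff.1 hwpos
    have hw5 : ‖w‖ ≤ 5 := by
      calc ‖w‖ ≤ ‖(θ : ℂ) * Complex.I‖ + ‖μ * τ‖ := norm_sub_le _ _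
        _ = |θ| + ‖μ‖ * τ := by simp [abs_of_pos hτ0]
        _ ≤ 5 := by linarith [Real.pi_lt_four]
    have hlow' := hlow w hw5
    have hE : 0 < ‖Complex.exp w - 1‖ := lt_of_lt_of_le (by positivity) hlow'
    have hE0 : Complex.exp w - 1 ≠ 0 := norm_pos_iff.1 hE
    have hsym : sampledSymbol τ (Complex.exp (θ * Complex.I)) μ = k τ / (Complex.exp w - 1) := by
      have he := Complex.exp_ne_zero (μ * τ)
      have e1 : Complex.exp w = Complex.exp (θ * Complex.I) / Complex.exp (μ * τ) := by
        rw [hw, Complex.exp_sub]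
      have h0 : Complex.exp (θ * Complex.I) - Complex.exp (μ * τ) ≠ 0 := by
        intro h
        apply hE0
        rw [e1, sub_eq_zero.1 h, div_self he, sub_self]
      simp only [sampledSymbol, k, e1, Complex.exp_neg]
      rw [div_sub_one he]
      field_simp
    have hG : (Complex.I * ((θ / τ : ℝ) : ℂ) - μ)⁻¹ = τ / w := by
      have : Complex.I * ((θ / τ : ℝ) : ℂ) - μ = w / τ := by
        rw [hw]
        push_cast
        field_simp
      rw [this, inv_div]
    -- In the first term 1/(exp w - 1) - 1/w stays bounded and k(τ) → 0; in the second k(τ) - τ =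
    -- O(τ²) while |w| ≥ τ|Re μ|.
    have hdec : k τ / (Complex.exp w - 1) - τ / w =
        k τ * (-(Complex.exp w - 1 - w) / (w * (Complex.exp w - 1))) + (k τ - τ) / w := by
      field_simp
      ring
    rw [hsym, hG, hdec]
    refine (norm_add_le _ _).trans (add_le_add ?_ ?_)
    · rw [norm_mul]
      refine mul_le_mul_of_nonneg_left ?_ (norm_nonneg _)
      rw [norm_div, norm_neg, norm_mul]
      calc ‖Complex.exp w - 1 - w‖ / (‖w‖ * ‖Complex.exp w - 1‖)
          ≤ (‖w‖ ^ 2 * Real.exp ‖w‖) / (‖w‖ * (m * ‖w‖)) := by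
            gcongr
            exact norm_exp_sub_one_sub_le w
        _ = Real.exp ‖w‖ / m := by field_simp
        _ ≤ Real.exp 5 / m := by gcongr
    · have hk : k τ - τ = -(Complex.exp (-(μ * τ)) - 1 - -(μ * τ)) / μ := by
        simp only [k]
        field_simp
        ring
      have hn : ‖-(μ * τ)‖ = ‖μ‖ * τ := by simp [abs_of_pos hτ0]
      have h1 := norm_exp_sub_one_sub_le (-(μ * τ))
      rw [hn] at h1
      have hμn : 0 < ‖μ‖ := norm_pos_iff.2 hμ0
      rw [norm_div, hk, norm_div, norm_neg]
      calc ‖Complex.exp (-(μ * τ)) - 1 - -(μ * τ)‖ / ‖μ‖ / ‖w‖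
          ≤ ((‖μ‖ * τ) ^ 2 * Real.exp (‖μ‖ * τ)) / ‖μ‖ / (τ * |μ.re|) := by gcongr
        _ = _ := by field_simp

/-! ### Resolvent bounds uniform over the eigenvalues -/

variable {C : ℝ}

/-- For small μ, exp(μτ) is near 1 and so away from z; for the other μ, |Re μ| is bounded below. -/
theorem exists_norm_sub_exp_inv_le (hC : 0 ≤ C) {τ : ℝ} (hτ : 0 < τ) {z : ℂ} (hz : ‖z‖ = 1)
    (hz1 : z ≠ 1) : ∃ K : ℝ, ∀ μ : ℂ, μ.re ≠ 0 → |μ.re|⁻¹ ≤ C * (1 + ‖μ‖⁻¹) →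
      ‖(z - Complex.exp (μ * τ))⁻¹‖ ≤ K := by
  have hz2 : 0 < ‖z - 1‖ := norm_pos_iff.2 (sub_ne_zero.2 hz1)
  have hcont : Continuous fun μ : ℂ => Complex.exp (μ * τ) := by fun_prop
  obtain ⟨η, hη, hclose⟩ := Metric.continuous_iff.1 hcont 0 (‖z - 1‖ / 2) (by positivity)
  simp only [dist_eq_norm, sub_zero, zero_mul, Complex.exp_zero] at hclose
  refine ⟨2 / ‖z - 1‖ + (1 + C * (1 + η⁻¹) / τ), fun μ hμ hμC => ?_⟩
  rcases lt_or_ge ‖μ‖ η with h | h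
  · have h1 := hclose μ h
    have h2 : ‖z - 1‖ / 2 ≤ ‖z - Complex.exp (μ * τ)‖ := by
      have := norm_sub_le_norm_sub_add_norm_sub z (Complex.exp (μ * τ)) 1
      linarith
    have h3 : ‖(z - Complex.exp (μ * τ))⁻¹‖ ≤ 2 / ‖z - 1‖ := by
      rw [norm_inv, ← inv_div]
      gcongr
    have : 0 ≤ 1 + C * (1 + η⁻¹) / τ := by positivity
    linarith
  · have hre : (μ * τ).re = μ.re * τ := by simp
    have h1 := norm_sub_exp_inv_le (w := μ * τ) hz (by rw [hre]; exact mul_ne_zero hμ hτ.ne')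
    have h2 : |(μ * τ).re|⁻¹ ≤ C * (1 + η⁻¹) / τ := by
      rw [hre, abs_mul, abs_of_pos hτ, mul_inv, ← div_eq_mul_inv]
      gcongr
      exact hμC.trans (by gcongr)
    have : 0 ≤ 2 / ‖z - 1‖ := by positivity
    linarith

theorem exists_norm_I_mul_sub_inv_le (hC : 0 ≤ C) {ω : ℝ} (hω : ω ≠ 0) :
    ∃ K : ℝ, ∀ μ : ℂ, μ.re ≠ 0 → |μ.re|⁻¹ ≤ C * (1 + ‖μ‖⁻¹) →
      ‖(Complex.I * ω - μ)⁻¹‖ ≤ K := by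
  have hω0 : 0 < |ω| := abs_pos.2 hω
  refine ⟨(|ω| / 2)⁻¹ + C * (1 + (|ω| / 2)⁻¹), fun μ hμ hμC => ?_⟩
  rcases lt_or_ge ‖μ‖ (|ω| / 2) with h | h
  · have h1 : |ω| / 2 ≤ ‖Complex.I * ω - μ‖ := by
      have := norm_sub_norm_le (Complex.I * ω) μ
      simp at this
      linarith
    have h2 : ‖(Complex.I * ω - μ)⁻¹‖ ≤ (|ω| / 2)⁻¹ := by
      rw [norm_inv]
      gcongr
    have : 0 ≤ C * (1 + (|ω| / 2)⁻¹) := by positivity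
    linarith
  · have h1 : |μ.re|⁻¹ ≤ C * (1 + (|ω| / 2)⁻¹) := hμC.trans (by gcongr)
    have := norm_I_mul_sub_inv_le ω hμ
    have : 0 ≤ (|ω| / 2)⁻¹ := by positivity
    linarith

/-- If only finitely many points of `S` lie in a right half-plane intersected with a sector larger
than the right half-plane, and none on the imaginary axis, then the real parts of the points of
`S` are bounded away from zero except near the origin, where they dominate the modulus. -/
theorem exists_abs_re_inv_le {S : Set ℂ} {α δ : ℝ} (hα : 0 < α) (hδ : 0 < δ)
    (hfin : (halfPlane (-α) ∩ sector (Real.pi / 2 + δ) ∩ S).Finite) (hS : S ∩ imaginaryAxis = ∅) :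
    ∃ C : ℝ, 0 ≤ C ∧ ∀ μ ∈ S, μ.re ≠ 0 ∧ |μ.re|⁻¹ ≤ C * (1 + ‖μ‖⁻¹) := by
  have hS' : ∀ μ ∈ S, μ.re ≠ 0 := fun μ hμ h0 => by
    have : μ ∈ S ∩ imaginaryAxis := ⟨hμ, h0⟩
    rw [hS] at this
    exact this
  have hsum : 0 ≤ ∑ s ∈ hfin.toFinset, |s.re|⁻¹ := Finset.sum_nonneg fun _ _ => by positivity
  -- One summand per case: the finitely many exceptional points, Re μ ≤ -α, and points outside the
  -- sector, where -Re μ ≥ sin δ · |μ|. In the last case |arg μ| ≤ π forces δ ≤ π/2, so sin δ > 0.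
  refine ⟨∑ s ∈ hfin.toFinset, |s.re|⁻¹ + α⁻¹ + |Real.sin δ|⁻¹, by positivity,
    fun μ hμ => ⟨hS' μ hμ, ?_⟩⟩
  have hre : 0 < |μ.re| := abs_pos.2 (hS' μ hμ)
  have hμ0 : μ ≠ 0 := by rintro rfl; simp at hre
  have hμpos : 0 < ‖μ‖ := norm_pos_iff.2 hμ0
  have hα' : 0 < α⁻¹ := by positivity
  have hsin' : 0 ≤ |Real.sin δ|⁻¹ := by positivity
  have hμinv : 0 < ‖μ‖⁻¹ := by positivity
  by_cases hmem : μ ∈ halfPlane (-α) ∩ sector (Real.pi / 2 + δ)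
  · have : |μ.re|⁻¹ ≤ ∑ s ∈ hfin.toFinset, |s.re|⁻¹ :=
      Finset.single_le_sum (f := fun s : ℂ => |s.re|⁻¹) (fun _ _ => by positivity)
        (hfin.mem_toFinset.2 ⟨hmem, hμ⟩)
    nlinarith
  · rcases le_or_gt μ.re (-α) with h | h
    · have : |μ.re|⁻¹ ≤ α⁻¹ := by
        gcongr
        rw [abs_of_neg (by linarith)]
        linarith
      nlinarith
    · have harg : Real.pi / 2 + δ ≤ |μ.arg| := by
        by_contra hc
        exact hmem ⟨h, hμ0, not_le.1 hc⟩
      have hpi := Complex.abs_arg_le_pi μ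
      have hsin : 0 < Real.sin δ := Real.sin_pos_of_pos_of_lt_pi hδ (by linarith [Real.pi_pos])
      have hcos : Real.cos |μ.arg| ≤ Real.cos (Real.pi / 2 + δ) :=
        Real.cos_le_cos_of_nonneg_of_le_pi (by linarith [Real.pi_pos]) hpi harg
      rw [Real.cos_abs, Complex.cos_arg hμ0, add_comm, Real.cos_add_pi_div_two,
        div_le_iff₀ hμpos] at hcos
      have h1 : Real.sin δ * ‖μ‖ ≤ |μ.re| := by
        have := neg_le_abs μ.re
        linarith
      have h2 : |μ.re|⁻¹ ≤ |Real.sin δ|⁻¹ * ‖μ‖⁻¹ := by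
        rw [abs_of_pos hsin, ← mul_inv]
        gcongr
      nlinarith [mul_pos hα' hμinv, mul_nonneg hsum hμinv.le]

end Estimates

/-! ### Transfer functions and their uniform convergence -/

section TransferFunctions

/-- The continuous-time transfer function on the imaginary axis, `F R(iω, A) B`. -/
def transfer (c lam : ℕ → ℂ) (ω : ℝ) : ℂ := ∑' n, c n * (Complex.I * ω - lam n)⁻¹

/-- The transfer function `F R(z, T(τ)) S(τ)` of the sampled system. -/
def sampledTransfer (c lam : ℕ → ℂ) (τ : ℝ) (z : ℂ) : ℂ := ∑' n, c n * sampledSymbol τ z (lam n)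

variable {c lam : ℕ → ℂ}

theorem norm_transfer_term_le (hre : ∀ n, (lam n).re ≠ 0) (n : ℕ) (ω : ℝ) :
    ‖c n * (Complex.I * ω - lam n)⁻¹‖ ≤ ‖c n‖ * |(lam n).re|⁻¹ := by
  rw [norm_mul]
  gcongr
  exact norm_I_mul_sub_inv_le ω (hre n)

theorem continuous_transfer (hre : ∀ n, (lam n).re ≠ 0)
    (hsum : Summable fun n => ‖c n‖ * |(lam n).re|⁻¹) : Continuous (transfer c lam) :=
  continuous_tsum (fun n => continuous_const.mul
      (Continuous.inv₀ (by fun_prop) fun ω => I_mul_sub_ne_zero ω (hre n)))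
    hsum fun n ω => norm_transfer_term_le hre n ω

theorem tendsto_transfer_cocompact (hre : ∀ n, (lam n).re ≠ 0)
    (hsum : Summable fun n => ‖c n‖ * |(lam n).re|⁻¹) :
    Tendsto (transfer c lam) (cocompact ℝ) (𝓝 0) := by
  have := tendsto_tsum_of_dominated_convergence (𝓕 := cocompact ℝ)
    (f := fun ω n => c n * (Complex.I * ω - lam n)⁻¹) (g := fun _ => 0) hsum (fun n => ?_)
    (Eventually.of_forall fun ω n => norm_transfer_term_le hre n ω)
  · rwa [tsum_zero] at this
  · have h1 : Tendsto (fun ω : ℝ => ‖Complex.I * ω - lam n‖) (cocompact ℝ) atTop := by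
      refine tendsto_atTop_mono (f := fun ω : ℝ => ‖ω‖ - ‖lam n‖) (fun ω => ?_)
        (tendsto_atTop_add_const_right _ _ tendsto_norm_cocompact_atTop)
      simpa using norm_sub_norm_le (Complex.I * ω) (lam n)
    have h2 := tendsto_inv₀_cobounded.comp (tendsto_norm_atTop_iff_cobounded.1 h1)
    simpa using h2.const_mul (c n)

theorem exists_le_norm_one_sub_transfer (hre : ∀ n, (lam n).re ≠ 0)
    (hsum : Summable fun n => ‖c n‖ * |(lam n).re|⁻¹) (hne : ∀ ω, transfer c lam ω ≠ 1) :
    ∃ ε : ℝ, 0 < ε ∧ ∀ ω, ε ≤ ‖1 - transfer c lam ω‖ := by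
  -- Since |1 - G| → 1, capping at 1/2 makes the function constant near infinity, so a minimum is
  -- attained.
  have hcont : Continuous fun ω => min ‖1 - transfer c lam ω‖ (1 / 2) :=
    (continuous_const.sub (continuous_transfer hre hsum)).norm.min continuous_const
  have hlim : Tendsto (fun ω => ‖1 - transfer c lam ω‖) (cocompact ℝ) (𝓝 1) := by
    have h1 := ((tendsto_transfer_cocompact hre hsum).const_sub 1).norm
    rwa [sub_zero, norm_one] at h1
  obtain ⟨ω₀, h₀⟩ := hcont.exists_forall_le' 0 (by
    filter_upwards [hlim.eventually_const_le (show (1 / 2 : ℝ) < 1 by norm_num)] with ω hω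
    rw [min_eq_right hω]
    exact min_le_right _ _)
  refine ⟨min ‖1 - transfer c lam ω₀‖ (1 / 2), lt_min ?_ (by norm_num), fun ω =>
    (h₀ ω).trans (min_le_left _ _)⟩
  exact norm_pos_iff.2 (sub_ne_zero.2 (hne ω₀).symm)

theorem norm_sampledTransfer_term_le (hre : ∀ n, (lam n).re ≠ 0) {τ : ℝ} (hτ : 0 < τ) {z : ℂ}
    (hz : ‖z‖ = 1) (n : ℕ) :
    ‖c n * sampledSymbol τ z (lam n)‖ ≤ τ * ‖c n‖ + ‖c n‖ * |(lam n).re|⁻¹ := by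
  rw [norm_mul, mul_comm τ, ← mul_add]
  gcongr
  exact norm_sampledSymbol_le hτ hz (hre n)

theorem summable_sampledTransfer (hre : ∀ n, (lam n).re ≠ 0) (hc : Summable fun n => ‖c n‖)
    (hsum : Summable fun n => ‖c n‖ * |(lam n).re|⁻¹) {τ : ℝ} (hτ : 0 < τ) {z : ℂ}
    (hz : ‖z‖ = 1) : Summable fun n => c n * sampledSymbol τ z (lam n) :=
  Summable.of_norm_bounded ((hc.mul_left τ).add hsum)
    fun n => norm_sampledTransfer_term_le hre hτ hz n

/-- The sampled transfer function converges to the continuous-time one as the sampling period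
tends to zero, uniformly on the unit circle. -/
theorem eventually_norm_sampledTransfer_sub_lt (hre : ∀ n, (lam n).re ≠ 0)
    (hc : Summable fun n => ‖c n‖) (hsum : Summable fun n => ‖c n‖ * |(lam n).re|⁻¹)
    {ε : ℝ} (hε : 0 < ε) :
    ∀ᶠ τ in 𝓝[>] (0 : ℝ), ∀ θ : ℝ, |θ| ≤ Real.pi →
      ‖sampledTransfer c lam τ (Complex.exp (θ * Complex.I)) - transfer c lam (θ / τ)‖ < ε := by
  -- Convergence along this filter of pairs (τ, θ) is convergence as τ ↓ 0 uniformly in |θ| ≤ π, so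
  -- dominated convergence along it gives uniformity directly.
  let l : Filter (ℝ × ℝ) := comap Prod.fst (𝓝[>] 0) ⊓ 𝓟 {p | |p.2| ≤ Real.pi}
  have hl : ∀ {P : ℝ → ℝ → Prop}, (∀ᶠ τ in 𝓝[>] (0 : ℝ), ∀ θ : ℝ, |θ| ≤ Real.pi → P τ θ) ↔
      ∀ᶠ p in l, P p.1 p.2 := by
    intro P
    simp only [l, eventually_inf_principal, eventually_comap, Set.mem_ofPred_eq, Prod.forall]
    refine eventually_congr (Eventually.of_forall fun τ => ⟨fun h a b hab hb => ?_, fun h θ hθ =>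
      h τ θ rfl hθ⟩)
    subst hab
    exact h b hb
  have hone : ∀ᶠ τ in 𝓝[>] (0 : ℝ), τ < 1 :=
    nhdsWithin_le_nhds (Iio_mem_nhds zero_lt_one)
  have hbound : ∀ᶠ p : ℝ × ℝ in l, 0 < p.1 ∧ p.1 < 1 := by
    refine (hl (P := fun τ _ => 0 < τ ∧ τ < 1)).1 ?_
    filter_upwards [hone, self_mem_nhdsWithin] with τ h1 h2 θ _ using ⟨h2, h1⟩
  have hlim := tendsto_tsum_of_dominated_convergence (𝓕 := l)
    (f := fun p n => c n * sampledSymbol p.1 (Complex.exp (p.2 * Complex.I)) (lam n) -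
      c n * (Complex.I * ((p.2 / p.1 : ℝ) : ℂ) - lam n)⁻¹) (g := fun _ => 0)
    (bound := fun n => ‖c n‖ + ‖c n‖ * |(lam n).re|⁻¹ + ‖c n‖ * |(lam n).re|⁻¹)
    ((hc.add hsum).add hsum) (fun n => ?_) ?_
  · rw [tsum_zero] at hlim
    refine hl.2 ?_
    filter_upwards [hlim.norm.eventually_lt_const (by simpa using hε), hbound] with p hp hp0
    rwa [Summable.tsum_sub (summable_sampledTransfer hre hc hsum hp0.1
      (Complex.norm_exp_ofReal_mul_I _))
      (Summable.of_norm_bounded hsum fun n => norm_transfer_term_le hre n _)] at hp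
  · obtain ⟨g, hg, hev⟩ := exists_norm_sampledSymbol_sub_le (hre n)
    have hg' : Tendsto (fun p : ℝ × ℝ => ‖c n‖ * g p.1) l (𝓝 0) := by
      simpa using (hg.comp (tendsto_comap.mono_left inf_le_left)).const_mul ‖c n‖
    refine squeeze_zero_norm' ?_ hg'
    have := hl.1 hev
    filter_upwards [this] with p hp
    rw [← mul_sub, norm_mul]
    gcongr
  · filter_upwards [hbound] with p hp n
    refine (norm_sub_le _ _).trans (add_le_add ?_ (norm_transfer_term_le hre n _))
    refine (norm_sampledTransfer_term_le hre hp.1 (Complex.norm_exp_ofReal_mul_I _) n).trans ?_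
    gcongr
    exact mul_le_of_le_one_left (norm_nonneg _) hp.2.le

theorem exists_forall_sampledTransfer_ne_one (hre : ∀ n, (lam n).re ≠ 0)
    (hc : Summable fun n => ‖c n‖) (hsum : Summable fun n => ‖c n‖ * |(lam n).re|⁻¹)
    (hne : ∀ ω, transfer c lam ω ≠ 1) :
    ∃ τstar : ℝ, 0 < τstar ∧ ∀ τ : ℝ, 0 < τ → τ < τstar → ∀ z : ℂ, ‖z‖ = 1 →
      sampledTransfer c lam τ z ≠ 1 := by
  obtain ⟨ε, hε, hlow⟩ := exists_le_norm_one_sub_transfer hre hsum hne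
  obtain ⟨τstar, hpos, h⟩ := (mem_nhdsGT_iff_exists_Ioo_subset).1
    (eventually_norm_sampledTransfer_sub_lt hre hc hsum hε)
  refine ⟨τstar, hpos, fun τ hτ hτ' z hz h1 => ?_⟩
  have h2 := h ⟨hτ, hτ'⟩ z.arg (Complex.abs_arg_le_pi z)
  have hz' : Complex.exp (z.arg * Complex.I) = z := by
    simpa [hz] using Complex.norm_mul_exp_arg_mul_I z
  rw [hz', h1] at h2
  exact (hlow _).not_gt h2

end TransferFunctions

/-! ### Spectrum of the sampled operator on the unit circle -/

section SampledSystem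

variable {X : Type*} [NormedAddCommGroup X] [InnerProductSpace ℂ X] [CompleteSpace X]
  {A : X →ₗ.[ℂ] X} {T : ℝ → X →L[ℂ] X} {B : ℂ →L[ℂ] X} {F : X →L[ℂ] ℂ} {lam : ℕ → ℂ}
  {φ ψ : ℕ → X} {b f : X}

/-- The products of the coordinates of the input and output vectors. -/
def transferCoeff (φ ψ : ℕ → X) (b f : X) (n : ℕ) : ℂ := inner ℂ (ψ n) b * inner ℂ f (φ n)

theorem SamplingAssumption.exists_re_inv_le (h : SamplingAssumption A B F lam φ ψ b f) :
    ∃ C : ℝ, 0 ≤ C ∧ ∀ n, (lam n).re ≠ 0 ∧ |(lam n).re|⁻¹ ≤ C * (1 + ‖lam n‖⁻¹) := by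
  obtain ⟨α, δ, hα, hδ, hfin⟩ := h.finite_unstable
  obtain ⟨C, hC, hle⟩ := exists_abs_re_inv_le hα hδ hfin h.no_imaginary_eigenvalue
  exact ⟨C, hC, fun n => hle _ ⟨n, rfl⟩⟩

theorem SamplingAssumption.re_ne_zero (h : SamplingAssumption A B F lam φ ψ b f) (n : ℕ) :
    (lam n).re ≠ 0 := by
  obtain ⟨C, -, hC⟩ := h.exists_re_inv_le
  exact (hC n).1

theorem SamplingAssumption.lam_ne_zero (h : SamplingAssumption A B F lam φ ψ b f) (n : ℕ) :
    lam n ≠ 0 := fun h0 => h.re_ne_zero n (by simp [h0])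

theorem SamplingAssumption.hasSum_F (h : SamplingAssumption A B F lam φ ψ b f) (x : X) :
    HasSum (fun n => (inner ℂ (ψ n) x * inner ℂ f (φ n) : ℂ)) (F x) := by
  rw [h.F_eq]
  exact h.rieszSpectral.rieszBasis.hasSum_inner h.biorthogonal f x

theorem SamplingAssumption.summable_coeff (h : SamplingAssumption A B F lam φ ψ b f) :
    Summable fun n => ‖transferCoeff φ ψ b f n‖ :=
  summable_norm_mul_of_sq (h.rieszSpectral.rieszBasis.summable_sq_coord h.biorthogonal b)
    (h.rieszSpectral.rieszBasis.summable_sq_inner f)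

/-- Since |Re λ_n|⁻¹ ≤ C(1 + |λ_n|⁻¹), it suffices to sum |c_n| and |c_n / λ_n|, both products of
square-summable sequences. -/
theorem SamplingAssumption.summable_coeff_mul_re_inv
    (h : SamplingAssumption A B F lam φ ψ b f) :
    Summable fun n => ‖transferCoeff φ ψ b f n‖ * |(lam n).re|⁻¹ := by
  obtain ⟨C, hC, hle⟩ := h.exists_re_inv_le
  have h1 := summable_norm_mul_of_sq h.b_summable
    (h.rieszSpectral.rieszBasis.summable_sq_inner f)
  refine Summable.of_nonneg_of_le (fun _ => by positivity) (fun n => ?_)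
    ((h.summable_coeff.add h1).mul_left C)
  calc ‖transferCoeff φ ψ b f n‖ * |(lam n).re|⁻¹
      ≤ ‖transferCoeff φ ψ b f n‖ * (C * (1 + ‖lam n‖⁻¹)) := by gcongr; exact (hle n).2
    _ = _ := by
      rw [transferCoeff, norm_mul, norm_mul, norm_div]
      ring

/-- Both the zero-frequency condition and the absence of imaginary eigenvalues of the closed loop
say that the open-loop transfer function avoids the value one. -/
theorem SamplingAssumption.transfer_ne_one (h : SamplingAssumption A B F lam φ ψ b f) (ω : ℝ) :
    transfer (transferCoeff φ ψ b f) lam ω ≠ 1 := by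
  intro h1
  rcases eq_or_ne ω 0 with rfl | hω
  · apply h.series_ne
    rw [← h1, transfer, ← tsum_neg]
    refine tsum_congr fun n => ?_
    rw [transferCoeff, Complex.ofReal_zero, mul_zero, zero_sub, inv_neg, mul_neg, neg_neg,
      div_eq_mul_inv]
  · obtain ⟨C, hC, hle⟩ := h.exists_re_inv_le
    obtain ⟨K, hK⟩ := exists_norm_I_mul_sub_inv_le hC hω
    have hR := h.rieszSpectral.rieszBasis
    -- x = R(iω, A)b, built coordinatewise. Then Ax = iωx - b and Fx = 1, so (A + BF)x = iωx.
    obtain ⟨x, hx⟩ := hR.summable_smul (summable_sq_mul_of_bounded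
      (fun n => hK (lam n) (hle n).1 (hle n).2) (hR.summable_sq_coord h.biorthogonal b))
    have hcoord := inner_of_hasSum_biorthogonal h.biorthogonal hx
    have hFx : F x = 1 := by
      rw [← h1, transfer, ← (h.hasSum_F x).tsum_eq]
      refine tsum_congr fun n => ?_
      rw [hcoord, transferCoeff]
      ring
    have hgraph : (x, (Complex.I * ω) • x - b) ∈ A.graph := by
      refine h.rieszSpectral.mem_graph_of_coord h.biorthogonal fun n => ?_
      have hn := I_mul_sub_ne_zero ω (h.re_ne_zero n)
      rw [inner_sub_right, inner_smul_right, hcoord]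
      field_simp
      ring
    obtain ⟨⟨x', hx0⟩, rfl, hAx⟩ := (LinearPMap.mem_graph_iff A).1 hgraph
    dsimp only at hFx hAx
    have hmem : Complex.I * ω ∈ pointSpectrum (closedLoop A B F) ∩ imaginaryAxis := by
      refine ⟨⟨x', ?_, hx0, ?_⟩, ?_⟩
      · rintro rfl
        simp at hFx
      · change B (F x') + A ⟨x', hx0⟩ = _
        rw [hAx, hFx, h.B_eq, one_smul]
        abel
      · change (Complex.I * (ω : ℂ)).re = 0
        simp
    rw [h.closedLoop_pointSpectrum] at hmem
    exact hmem

variable {τ : ℝ} {z : ℂ}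

theorem SamplingAssumption.sampledOperator_coord (h : SamplingAssumption A B F lam φ ψ b f)
    (hT : IsC0Semigroup T) (hA : IsGenerator T A) (hτ : 0 < τ) (x : X) (n : ℕ) :
    inner ℂ (ψ n) (sampledOperator T B F τ x) =
      Complex.exp (lam n * τ) * inner ℂ (ψ n) x +
        F x * inner ℂ (ψ n) b * ((Complex.exp (lam n * τ) - 1) / lam n) :=
  SampledData.sampledOperator_coord hA hT h.rieszSpectral.rieszBasis h.biorthogonal
    h.rieszSpectral.eigenvector h.lam_ne_zero h.B_eq F hτ.le x n

theorem SamplingAssumption.circle_sub_exp_ne_zero (h : SamplingAssumption A B F lam φ ψ b f)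
    (hτ : 0 < τ) (hz : ‖z‖ = 1) (n : ℕ) : z - Complex.exp (lam n * τ) ≠ 0 :=
  sub_exp_ne_zero hz (by simpa using ⟨h.re_ne_zero n, hτ.ne'⟩)

/-- Solving coordinatewise expresses x as Fx times R(z, T(τ))S(τ); applying F gives Fx = Fx ·
G_τ(z), so Fx = 0. Only termwise division is needed, so z = 1 is allowed. -/
theorem SamplingAssumption.eq_zero_of_sampledOperator_eq_smul
    (h : SamplingAssumption A B F lam φ ψ b f) (hT : IsC0Semigroup T) (hA : IsGenerator T A)
    (hτ : 0 < τ) (hz : ‖z‖ = 1)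
    (hne : sampledTransfer (transferCoeff φ ψ b f) lam τ z ≠ 1) {x : X}
    (hx : sampledOperator T B F τ x = z • x) : x = 0 := by
  have hcoord : ∀ n, inner ℂ (ψ n) x =
      F x * (inner ℂ (ψ n) b * sampledSymbol τ z (lam n)) := by
    intro n
    have h1 := h.sampledOperator_coord hT hA hτ x n
    rw [hx, inner_smul_right] at h1
    have h2 := h.circle_sub_exp_ne_zero hτ hz n
    have h3 := h.lam_ne_zero n
    apply mul_left_cancel₀ h2
    rw [sampledSymbol]
    field_simp
    field_simp at h1
    linear_combination h1
  have hF : F x = F x * sampledTransfer (transferCoeff φ ψ b f) lam τ z := by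
    rw [sampledTransfer, ← tsum_mul_left, ← (h.hasSum_F x).tsum_eq]
    refine tsum_congr fun n => ?_
    rw [hcoord, (h.hasSum_F x).tsum_eq, transferCoeff]
    ring
  have hF0 : F x = 0 := by
    by_contra h0
    exact hne (mul_left_cancel₀ h0 (by rw [← hF, mul_one]))
  exact h.rieszSpectral.rieszBasis.eq_zero_of_coord h.biorthogonal fun n => by
    rw [hcoord, hF0, zero_mul]

theorem SamplingAssumption.exists_smul_sub_sampledOperator_eq
    (h : SamplingAssumption A B F lam φ ψ b f) (hT : IsC0Semigroup T) (hA : IsGenerator T A)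
    (hτ : 0 < τ) (hz : ‖z‖ = 1) (hz1 : z ≠ 1)
    (hne : sampledTransfer (transferCoeff φ ψ b f) lam τ z ≠ 1) (y : X) :
    ∃ x : X, z • x - sampledOperator T B F τ x = y := by
  obtain ⟨C, hC, hle⟩ := h.exists_re_inv_le
  obtain ⟨K, hK⟩ := exists_norm_sub_exp_inv_le hC hτ hz hz1
  have hR := h.rieszSpectral.rieszBasis
  have hsolve : ∀ v : X, ∃ x : X, ∀ n, inner ℂ (ψ n) x =
      (z - Complex.exp (lam n * τ))⁻¹ * inner ℂ (ψ n) v := fun v => by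
    obtain ⟨x, hx⟩ := hR.summable_smul (summable_sq_mul_of_bounded
      (fun n => hK (lam n) (hle n).1 (hle n).2) (hR.summable_sq_coord h.biorthogonal v))
    exact ⟨x, inner_of_hasSum_biorthogonal h.biorthogonal hx⟩
  obtain ⟨x₁, hx₁⟩ := hsolve y
  obtain ⟨x₂, hx₂⟩ := hsolve (inputOperator T B τ 1)
  have hS : ∀ n, inner ℂ (ψ n) x₂ = inner ℂ (ψ n) b * sampledSymbol τ z (lam n) := fun n => by
    have h2 := h.circle_sub_exp_ne_zero hτ hz n
    have h3 := h.lam_ne_zero n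
    rw [hx₂, inputOperator_coord hA hT hR h.biorthogonal h.rieszSpectral.eigenvector h.lam_ne_zero
      h.B_eq hτ.le, sampledSymbol]
    field_simp
  have hF₂ : F x₂ = sampledTransfer (transferCoeff φ ψ b f) lam τ z := by
    rw [sampledTransfer, ← (h.hasSum_F x₂).tsum_eq]
    refine tsum_congr fun n => ?_
    rw [hS, transferCoeff]
    ring
  have hne' : 1 - F x₂ ≠ 0 := by
    rw [hF₂]
    exact sub_ne_zero.2 hne.symm
  -- Sherman–Morrison formula with x₁ = R(z, T(τ))y and x₂ = R(z, T(τ))S(τ)1.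
  refine ⟨x₁ + (F x₁ / (1 - F x₂)) • x₂, hR.ext_coord h.biorthogonal fun n => ?_⟩
  have hF : F (x₁ + (F x₁ / (1 - F x₂)) • x₂) = F x₁ / (1 - F x₂) := by
    rw [map_add, map_smul, smul_eq_mul]
    field_simp
    ring
  have h2 := h.circle_sub_exp_ne_zero hτ hz n
  have h3 := h.lam_ne_zero n
  rw [inner_sub_right, h.sampledOperator_coord hT hA hτ, hF, inner_smul_right, inner_add_right,
    inner_smul_right, hx₁, hS, sampledSymbol]
  field_simp
  ring

/-- As λ_n → 0, (1 - Δ(τ))φ_n = (1 - exp(λ_n τ))φ_n - S(τ)Fφ_n → 0, whereas biorthogonality keeps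
‖φ_n‖ away from 0. This excludes a bounded left inverse. -/
theorem SamplingAssumption.one_mem_spectrum (h : SamplingAssumption A B F lam φ ψ b f)
    (hT : IsC0Semigroup T) (hA : IsGenerator T A) (hτ : 0 < τ) :
    (1 : ℂ) ∈ spectrum ℂ (sampledOperator T B F τ) := by
  intro hunit
  have hR := h.rieszSpectral.rieszBasis
  obtain ⟨R, hRinv⟩ := hunit.exists_left_inv
  rw [map_one] at hRinv
  let l : Filter ℕ := comap lam (𝓝 0)
  have hl : l.NeBot := by
    refine comap_neBot fun t ht => ?_
    obtain ⟨_, ht', n, rfl⟩ := mem_closure_iff_nhds.1 h.zero_mem_closure t ht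
    exact ⟨n, ht'⟩
  -- No λ_n is 0, so λ_n → 0 forces n to leave every finite set, and square summability gives Fφ_n →
  -- 0.
  have hlco : l ≤ cofinite := by
    refine le_cofinite_iff_compl_singleton_mem.2 fun n => ?_
    refine mem_comap.2 ⟨{lam n}ᶜ, isOpen_compl_singleton.mem_nhds (h.lam_ne_zero n).symm, ?_⟩
    rintro m hm rfl
    exact hm rfl
  have hf : Tendsto (fun n => (inner ℂ f (φ n) : ℂ)) l (𝓝 0) := by
    have h1 := (hR.summable_sq_inner f).tendsto_cofinite_zero.mono_left hlco
    have h2 := h1.sqrt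
    simp only [Real.sqrt_zero, Real.sqrt_sq (norm_nonneg _)] at h2
    exact tendsto_zero_iff_norm_tendsto_zero.2 h2
  have he : Tendsto (fun n => 1 - Complex.exp (lam n * τ)) l (𝓝 0) := by
    have : Continuous fun μ : ℂ => 1 - Complex.exp (μ * τ) := by fun_prop
    exact (by simpa using this.tendsto 0 :
      Tendsto (fun μ : ℂ => 1 - Complex.exp (μ * τ)) (𝓝 0) (𝓝 0)).comp tendsto_comap
  obtain ⟨M, hM, hup⟩ := hR.exists_norm_sum_sq_le
  obtain ⟨M', hM', hlow⟩ := hR.exists_sum_sq_coord_le h.biorthogonal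
  have hφ : ∀ n, ‖φ n‖ ≤ Real.sqrt M := fun n => by
    apply Real.le_sqrt_of_sq_le
    simpa using hup {n} (fun _ => 1)
  have hid : ∀ n, φ n = R ((1 - Complex.exp (lam n * τ)) • φ n -
      inputOperator T B τ (inner ℂ f (φ n))) := fun n => by
    have h1 : (1 - sampledOperator T B F τ) (φ n) = (1 - Complex.exp (lam n * τ)) • φ n -
        inputOperator T B τ (inner ℂ f (φ n)) := by
      have h2 := hA.apply_eigenvector hT (h.rieszSpectral.eigenvector n) hτ.le
      simp only [sampledOperator, sub_apply, add_apply, ContinuousLinearMap.comp_apply,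
        one_apply_eq_self, h2, h.F_eq, sub_smul, one_smul]
      abel
    rw [← h1, ← mul_apply_eq_comp, hRinv, one_apply_eq_self]
  have hlim1 : Tendsto (fun n => (1 - Complex.exp (lam n * τ)) • φ n) l (𝓝 0) := by
    have h1 : Tendsto (fun n => ‖1 - Complex.exp (lam n * τ)‖ * Real.sqrt M) l (𝓝 0) := by
      simpa using he.norm.mul_const (Real.sqrt M)
    refine squeeze_zero_norm (fun n => ?_) h1
    rw [norm_smul]
    gcongr
    exact hφ n
  have hlim2 : Tendsto (fun n => inputOperator T B τ (inner ℂ f (φ n))) l (𝓝 0) := by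
    have h1 := (inputOperator T B τ).continuous.tendsto 0
    rw [map_zero] at h1
    exact h1.comp hf
  have hlim : Tendsto φ l (𝓝 0) := by
    have h1 := (R.continuous.tendsto _).comp (hlim1.sub hlim2)
    rw [sub_zero, map_zero] at h1
    exact h1.congr fun n => (hid n).symm
  have hone : ∀ n, 1 ≤ M' * ‖φ n‖ ^ 2 := fun n => by
    simpa [h.biorthogonal] using hlow {n} (φ n)
  have h0 : Tendsto (fun n => M' * ‖φ n‖ ^ 2) l (𝓝 0) := by
    simpa using (hlim.norm.pow 2).const_mul M'
  exact absurd (ge_of_tendsto' h0 hone) (by norm_num)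

end SampledSystem

end SampledData

end

theorem theorem3p1 {X : Type*} [NormedAddCommGroup X] [InnerProductSpace ℂ X] [CompleteSpace X]
    (A : X →ₗ.[ℂ] X) (T : ℝ → X →L[ℂ] X)
    (hT : SampledData.IsC0Semigroup T) (hA : SampledData.IsGenerator T A)
    (B : ℂ →L[ℂ] X) (F : X →L[ℂ] ℂ)
    (lam : ℕ → ℂ) (φ ψ : ℕ → X) (b f : X)
    (h : SampledData.SamplingAssumption A B F lam φ ψ b f) :
    ∃ τstar : ℝ, 0 < τstar ∧ ∀ τ : ℝ, 0 < τ → τ < τstar →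
      {z : ℂ | Module.End.HasEigenvalue
          (SampledData.sampledOperator T B F τ : X →ₗ[ℂ] X) z} ∩ Metric.sphere 0 1 = ∅ ∧
      spectrum ℂ (SampledData.sampledOperator T B F τ) ∩ Metric.sphere 0 1 = {1} := by
  obtain ⟨τstar, hpos, hne⟩ := SampledData.exists_forall_sampledTransfer_ne_one h.re_ne_zero
    h.summable_coeff h.summable_coeff_mul_re_inv h.transfer_ne_one
  have hinj : ∀ τ, 0 < τ → τ < τstar → ∀ z : ℂ, ‖z‖ = 1 → ∀ x : X,
      SampledData.sampledOperator T B F τ x = z • x → x = 0 := fun τ hτ hτ' z hz x hx =>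
    h.eq_zero_of_sampledOperator_eq_smul hT hA hτ hz (hne τ hτ hτ' z hz) hx
  refine ⟨τstar, hpos, fun τ hτ hτ' => ⟨?_, ?_⟩⟩
  · refine Set.eq_empty_iff_forall_notMem.2 ?_
    rintro z ⟨hz, hz1⟩
    obtain ⟨x, hx⟩ := Module.End.HasEigenvalue.exists_hasEigenvector hz
    exact hx.2 (hinj τ hτ hτ' z (by simpa using hz1) x hx.apply_eq_smul)
  · refine Set.Subset.antisymm ?_ ?_
    · rintro z ⟨hz, hz1⟩
      have hz1 : ‖z‖ = 1 := by simpa using hz1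
      by_contra hzne
      -- Bijectivity suffices by the bounded inverse theorem.
      refine hz (ContinuousLinearMap.isUnit_iff_bijective.2 ⟨?_, fun y => ?_⟩)
      · refine (injective_iff_map_eq_zero _).2 fun x hx => ?_
        refine hinj τ hτ hτ' z hz1 x ?_
        rw [sub_apply, sub_eq_zero] at hx
        exact hx.symm
      · exact h.exists_smul_sub_sampledOperator_eq hT hA hτ hz1 hzne (hne τ hτ hτ' z hz1) y
    · rintro _ rfl
      exact ⟨h.one_mem_spectrum hT hA hτ, by simp⟩
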